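/- For integers $m, n \ge 1$ and $r \ge 0$, let the $r$-Whitney numbers of the second kind $W_{m,r}(n,k)$, $0 \le k \le n$, be defined by the polynomial identity $$(mx+r)^n = \sum_{k=0}^{n} m^k\, W_{m,r}(n,k)\,(x)_k, \qquad (x)_k = x(x-1)\cdots(x-k+1),$$ and let $D_{m,r}(n) = \sum_{k=0}^{n} W_{m,r}(n,k)$ be the $r$-Dowling numbers. There is an absolute constant $C > 0$ such that the following holds for all positive integers $m, n, r$ with $n > e^m$. There is exactly one real number $\delta > 0$ with $$\delta\,(r + e^{m\delta}) = n,$$ and, for this $\delta$, with $$g_0 = r\delta + \frac{e^{m\delta}-1}{m}, \qquad g_2 = \frac{n + m\delta^2 e^{m\delta}}{2},$$ we have $$D_{m,r}(n) = \frac{e^{g_0}}{\sqrt{4\pi g_2}}\cdot\frac{n!}{\delta^n}\,(1+E) \quad\text{for some real } E \text{ with}\quad |E| \le C\,\frac{(\log n)^{12}}{\sqrt n}.$$ -/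

import Mathlib

open Polynomial

/-- The falling factorials `(X)_k = X (X - 1) ⋯ (X - k + 1)`, as a sequence of real polynomials
with `(X)_k` of degree `k`. -/
noncomputable def fallingFactorialSeq : Polynomial.Sequence ℝ where
  elems' k := descPochhammer ℝ k
  degree_eq' k := by
    rw [Polynomial.degree_eq_natDegree (monic_descPochhammer ℝ k).ne_zero,
      descPochhammer_natDegree]

theorem isUnit_leadingCoeff_fallingFactorialSeq (k : ℕ) :
    IsUnit (fallingFactorialSeq k).leadingCoeff :=
  isUnit_iff_ne_zero.mpr (leadingCoeff_ne_zero.mpr (fallingFactorialSeq.ne_zero k))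

/-- The falling factorials as a basis of `ℝ[X]`. -/
noncomputable def fallingFactorialBasis : Module.Basis ℕ ℝ ℝ[X] :=
  fallingFactorialSeq.basis isUnit_leadingCoeff_fallingFactorialSeq

theorem fallingFactorialBasis_apply (k : ℕ) :
    fallingFactorialBasis k = descPochhammer ℝ k :=
  fallingFactorialSeq.basis_eq_self isUnit_leadingCoeff_fallingFactorialSeq k

/-- The `r`-Whitney numbers of the second kind `W_{m,r}(n, k)`, for `m ≥ 1`: the coefficient of
the falling factorial `(X)_k` in the expansion of `(m X + r) ^ n` is `m ^ k * W_{m,r}(n, k)`. -/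
noncomputable def rWhitney (m r n k : ℕ) : ℝ :=
  fallingFactorialBasis.repr ((C (m : ℝ) * X + C (r : ℝ)) ^ n) k / (m : ℝ) ^ k

/-- The `r`-Dowling numbers `D_{m,r}(n) = ∑_{k = 0}^{n} W_{m,r}(n, k)`. -/
noncomputable def rDowling (m r n : ℕ) : ℝ :=
  ∑ k ∈ Finset.range (n + 1), rWhitney m r n k

/-- The identity that defines the `r`-Whitney numbers of the second kind. -/
theorem rWhitney_spec {m : ℕ} (hm : 0 < m) (r n : ℕ) :
    (C (m : ℝ) * X + C (r : ℝ)) ^ n =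
      ∑ k ∈ Finset.range (n + 1), C ((m : ℝ) ^ k * rWhitney m r n k) * descPochhammer ℝ k := by
  have hm' : (m : ℝ) ≠ 0 := by exact_mod_cast hm.ne'
  set P : ℝ[X] := (C (m : ℝ) * X + C (r : ℝ)) ^ n with hP
  have hdeg : P ∈ degreeLE ℝ (n : WithBot ℕ) := by
    rw [mem_degreeLE, ← natDegree_le_iff_degree_le]
    calc P.natDegree ≤ n * (C (m : ℝ) * X + C (r : ℝ)).natDegree := natDegree_pow_le
      _ ≤ n * 1 := Nat.mul_le_mul_left _ natDegree_linear_le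
      _ = n := mul_one n
  have hspan : P ∈ Submodule.span ℝ (fallingFactorialBasis '' Set.Iic n) := by
    have h := fallingFactorialSeq.span_degreeLE (m := n)
      (fun i _ => isUnit_leadingCoeff_fallingFactorialSeq i)
    rw [← h] at hdeg
    have hb : (fallingFactorialBasis : ℕ → ℝ[X]) = fallingFactorialSeq := funext fun k =>
      fallingFactorialSeq.basis_eq_self isUnit_leadingCoeff_fallingFactorialSeq k
    rw [hb]
    exact hdeg
  have hsupp : (fallingFactorialBasis.repr P).support ⊆ Finset.range (n + 1) := by
    intro k hk
    have := (fallingFactorialBasis.mem_span_image).mp hspan (Finset.mem_coe.mpr hk)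
    exact Finset.mem_range.mpr (Nat.lt_succ_of_le this)
  conv_lhs => rw [← fallingFactorialBasis.linearCombination_repr P]
  rw [Finsupp.linearCombination_apply, Finsupp.sum_of_support_subset _ hsupp _ (by simp)]
  refine Finset.sum_congr rfl fun k _ => ?_
  rw [fallingFactorialBasis_apply, smul_eq_C_mul, rWhitney, ← hP,
    mul_div_cancel₀ _ (pow_ne_zero k hm')]

/-- The defining identity determines the `r`-Whitney numbers of the second kind. -/
theorem rWhitney_unique {m : ℕ} (hm : 0 < m) (r n : ℕ) (w : ℕ → ℝ)
    (hw : (C (m : ℝ) * X + C (r : ℝ)) ^ n =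
      ∑ k ∈ Finset.range (n + 1), C ((m : ℝ) ^ k * w k) * descPochhammer ℝ k)
    {k : ℕ} (hk : k ≤ n) : w k = rWhitney m r n k := by
  have hm' : (m : ℝ) ≠ 0 := by exact_mod_cast hm.ne'
  have hk' : k < n + 1 := Nat.lt_succ_of_le hk
  rw [rWhitney, hw]
  simp only [← smul_eq_C_mul, ← fallingFactorialBasis_apply, map_sum, map_smul,
    Module.Basis.repr_self, Finsupp.smul_single, smul_eq_mul, mul_one, Finsupp.finsetSum_apply,
    Finsupp.single_apply, Finset.sum_ite_eq', Finset.mem_range, hk', if_true]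
  rw [mul_div_cancel_left₀ _ (pow_ne_zero k hm')]

/-- The quantity `g_0 = r δ + (e ^ (m δ) - 1) / m`. -/
noncomputable def gZero (m r : ℕ) (δ : ℝ) : ℝ :=
  r * δ + (Real.exp (m * δ) - 1) / m

/-- The quantity `g_2 = (n + m δ ^ 2 e ^ (m δ)) / 2`. -/
noncomputable def gTwo (m n : ℕ) (δ : ℝ) : ℝ :=
  (n + m * δ ^ 2 * Real.exp (m * δ)) / 2

/-!
The `r`-Dowling number `D(n) = D_{m,r}(n)` is, up to the factor `e ^ (-1 / m)`, the sum
`∑ j, (m j + r) ^ n / (m ^ j j!)` (`hasSum_rDowling`), because the falling factorial moments of a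
Poisson variable of parameter `t` are the powers of `t`. Hence `exp (r z + (e ^ (m z) - 1) / m)` is
the exponential generating function of `D(n)`, and Cauchy's formula on the circle of radius `δ`
expresses `2 π δ ^ n D(n) / n!` as `∫ t in -π..π, exp (h t - n t i)`, where `h t` is the exponent at
`z = δ e ^ (i t)` (`integral_cexp_dowlingExponent`).

The equation for `δ` says that the first-order term of `h t - n t i` at `t = 0` vanishes, and
`-2 g₂` is its second derivative there. Put `L = log n`. The hypothesis `e ^ m < n` gives `m δ < L`
(`saddlePoint_mul_lt_log`), and with it two estimates that are uniform in `m` and `r`: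

* `h t - n t i = g₀ - g₂ t ^ 2` up to an error of at most `5 n L ^ 2 |t| ^ 3`
  (`norm_dowlingExponent_sub_le`);
* `Re (h t) ≤ g₀ - b t ^ 2` with `b = n / (15 L)`, for all `|t| ≤ π` (`re_dowlingExponent_sub_le`).

Since `|e ^ a - e ^ b| ≤ e ^ M |a - b|` when both real parts are at most `M`, the normalized
integrand differs from the Gaussian `e ^ (-g₂ t ^ 2)` by at most
`5 n L ^ 2 |t| ^ 3 e ^ (-b t ^ 2)`, and the same bound covers the tails of the Gaussian outside
`[-π, π]`. No separate treatment of the part of the circle away from the saddle point is needed.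
Integrating gives an absolute error `O (L ^ 4 / n)`, against the Gaussian integral `√(π / g₂)` with
`g₂ ≤ n L`. The relative error is thus `O (L ^ 5 / √n)`, which is stronger than required.
-/

/-! ### The Dobinski-type formula and Cauchy's formula -/

open scoped Nat in
/-- The factorial moments of the Poisson distribution, up to its normalizing constant `e ^ (-t)`. -/
theorem hasSum_pow_div_factorial_mul_descPochhammer (t : ℝ) (k : ℕ) :
    HasSum (fun j : ℕ => t ^ j / j ! * (descPochhammer ℝ k).eval (j : ℝ))
      (t ^ k * Real.exp t) := by
  rw [← hasSum_nat_add_iff' k]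
  have h0 : ∑ i ∈ Finset.range k, t ^ i / (i ! : ℝ) * (descPochhammer ℝ k).eval (i : ℝ) = 0 :=
    Finset.sum_eq_zero fun i hi => by
      rw [descPochhammer_eval_coe_nat_of_lt (Finset.mem_range.mp hi), mul_zero]
  rw [h0, sub_zero, Real.exp_eq_exp_ℝ]
  convert! (NormedSpace.expSeries_div_hasSum_exp t).mul_left (t ^ k) using 2 with j
  rw [descPochhammer_eval_eq_descFactorial]
  have h := Nat.factorial_mul_descFactorial (Nat.le_add_left k j)
  rw [Nat.add_sub_cancel] at h
  rw [← h]
  push_cast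
  have h1 : (j ! : ℝ) ≠ 0 := by positivity
  have h2 : ((j + k).descFactorial k : ℝ) ≠ 0 := by
    have : ((j + k).descFactorial k) ≠ 0 := by
      rw [Ne, Nat.descFactorial_eq_zero_iff_lt]; omega
    exact_mod_cast this
  field_simp
  ring

open scoped Nat in
/-- The Dobinski-type formula: the `r`-Dowling number is the `n`-th moment of `m N + r` for a
Poisson variable `N` of parameter `1 / m`. -/
theorem hasSum_rDowling {m : ℕ} (hm : 0 < m) (r n : ℕ) :
    HasSum (fun j : ℕ => (1 / m : ℝ) ^ j / j ! * (m * j + r : ℝ) ^ n)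
      (Real.exp (1 / m) * rDowling m r n) := by
  have hm' : (m : ℝ) ≠ 0 := by exact_mod_cast hm.ne'
  have h := hasSum_sum (s := Finset.range (n + 1)) fun k _ =>
    (hasSum_pow_div_factorial_mul_descPochhammer (1 / m : ℝ) k).mul_left
      ((m : ℝ) ^ k * rWhitney m r n k)
  convert! h using 1
  · funext j
    have := congrArg (Polynomial.eval (j : ℝ)) (rWhitney_spec hm r n)
    simp only [eval_pow, eval_add, eval_mul, eval_C, eval_X, eval_finsetSum] at this
    rw [this, Finset.mul_sum]
    exact Finset.sum_congr rfl fun k _ => by ring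
  · rw [rDowling, Finset.mul_sum]
    refine Finset.sum_congr rfl fun k _ => ?_
    rw [one_div, inv_pow]
    field_simp

/-- Termwise integration of a series of continuous functions dominated by a summable sequence of
constants. -/
theorem hasSum_intervalIntegral_of_norm_le {f : ℕ → ℝ → ℂ} {g : ℝ → ℂ} {u : ℕ → ℝ} (a b : ℝ)
    (hf : ∀ j, Continuous (f j)) (hu : Summable u) (hfu : ∀ j t, ‖f j t‖ ≤ u j)
    (hg : ∀ t, HasSum (fun j => f j t) (g t)) :
    HasSum (fun j => ∫ t in a..b, f j t) (∫ t in a..b, g t) :=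
  intervalIntegral.hasSum_integral_of_dominated_convergence (fun j _ => u j)
    (fun j => (hf j).aestronglyMeasurable) (fun j => .of_forall fun t _ => hfu j t)
    (.of_forall fun _ _ => hu) intervalIntegrable_const (.of_forall fun t _ => hg t)

theorem integral_cexp_int_mul_I (k : ℤ) :
    ∫ t in -Real.pi..Real.pi, Complex.exp (k * t * Complex.I) =
      if k = 0 then (2 * Real.pi : ℂ) else 0 := by
  split_ifs with hk
  · subst hk
    simp
    ring
  · have hc : (k : ℂ) * Complex.I ≠ 0 := by simp [hk]
    have h := integral_exp_mul_complex (a := -Real.pi) (b := Real.pi) hc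
    have h2 : Complex.exp (k * Complex.I * Real.pi) =
        Complex.exp (k * Complex.I * (-Real.pi : ℝ)) := by
      rw [Complex.exp_eq_exp_iff_exists_int]
      exact ⟨k, by push_cast; ring⟩
    rw [h2, sub_self, zero_div] at h
    rw [← h]
    exact intervalIntegral.integral_congr fun t _ => by ring_nf

theorem norm_cexp_nat_mul_I (n : ℕ) (t : ℝ) : ‖Complex.exp (-(n * t * Complex.I))‖ = 1 := by
  rw [show -(n * t * Complex.I : ℂ) = ((-(n * t) : ℝ) : ℂ) * Complex.I by push_cast; ring,
    Complex.norm_exp_ofReal_mul_I]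

open scoped Nat in
theorem hasSum_cexp (z : ℂ) : HasSum (fun k : ℕ => z ^ k / k !) (Complex.exp z) := by
  rw [Complex.exp_eq_exp_ℂ]
  exact NormedSpace.expSeries_div_hasSum_exp z

open scoped Nat in
/-- The Taylor coefficients of `z ↦ exp (w z)`, extracted by Cauchy's formula on the unit circle. -/
theorem integral_cexp_mul_cexp_I (w : ℂ) (n : ℕ) :
    ∫ t in -Real.pi..Real.pi, Complex.exp (w * Complex.exp (t * Complex.I)) *
      Complex.exp (-(n * t * Complex.I)) = 2 * Real.pi * (w ^ n / n !) := by
  have h := hasSum_intervalIntegral_of_norm_le (-Real.pi) Real.pi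
    (f := fun k t => (w * Complex.exp (t * Complex.I)) ^ k / k ! *
      Complex.exp (-(n * t * Complex.I)))
    (g := fun t => Complex.exp (w * Complex.exp (t * Complex.I)) *
      Complex.exp (-(n * t * Complex.I)))
    (u := fun k => ‖w‖ ^ k / k !) (fun j => by fun_prop) (Real.summable_pow_div_factorial _)
    (fun k t => by
      rw [norm_mul, norm_cexp_nat_mul_I, norm_div, norm_pow, norm_mul,
        Complex.norm_exp_ofReal_mul_I, mul_one, mul_one, Complex.norm_natCast])
    (fun t => (hasSum_cexp _).mul_right _)
  refine h.unique ?_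
  have h1 : ∀ k : ℕ, ∫ t in -Real.pi..Real.pi, (w * Complex.exp (t * Complex.I)) ^ k / k ! *
      Complex.exp (-(n * t * Complex.I)) = if k = n then 2 * Real.pi * (w ^ n / n !) else 0 := by
    intro k
    have h2 : ∀ t : ℝ, (w * Complex.exp (t * Complex.I)) ^ k / k ! *
        Complex.exp (-(n * t * Complex.I)) =
        w ^ k / k ! * Complex.exp (((k - n : ℤ) : ℂ) * t * Complex.I) := by
      intro t
      have : (((k - n : ℤ) : ℂ) * t * Complex.I) =
        k * (t * Complex.I) + -(n * t * Complex.I) := by push_cast; ring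
      rw [this, Complex.exp_add, Complex.exp_nat_mul, mul_pow]
      ring
    simp_rw [h2]
    rw [intervalIntegral.integral_const_mul, integral_cexp_int_mul_I]
    by_cases hk : k = n
    · subst hk
      simp
      ring
    · rw [if_neg hk, if_neg (by omega), mul_zero]
  simp_rw [h1]
  exact hasSum_ite_eq n _

/-- The logarithm of the exponential generating function of the `r`-Dowling numbers, on the circle
of radius `δ`: `r z + (e ^ (m z) - 1) / m` at `z = δ e ^ (i t)`. -/
noncomputable def dowlingExponent (m r : ℕ) (δ t : ℝ) : ℂ :=
  r * (δ * Complex.exp (t * Complex.I)) +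
    (Complex.exp (m * (δ * Complex.exp (t * Complex.I))) - 1) / m

theorem dowlingExponent_zero (m r : ℕ) (δ : ℝ) : dowlingExponent m r δ 0 = gZero m r δ := by
  simp [dowlingExponent, gZero]

@[fun_prop]
theorem continuous_dowlingExponent (m r : ℕ) (δ : ℝ) : Continuous (dowlingExponent m r δ) := by
  unfold dowlingExponent
  fun_prop

open scoped Nat in
/-- Cauchy's formula for the `r`-Dowling numbers. -/
theorem integral_cexp_dowlingExponent {m : ℕ} (hm : 0 < m) (r n : ℕ) (δ : ℝ) :
    ∫ t in -Real.pi..Real.pi, Complex.exp (dowlingExponent m r δ t - n * t * Complex.I) =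
      ((2 * Real.pi * (δ ^ n / n ! * rDowling m r n) : ℝ) : ℂ) := by
  have hm' : (m : ℂ) ≠ 0 := by exact_mod_cast hm.ne'
  have h := hasSum_intervalIntegral_of_norm_le (-Real.pi) Real.pi
    (f := fun j t => (1 / m : ℂ) ^ j / j ! *
      (Complex.exp (((m * j + r) * δ : ℂ) * Complex.exp (t * Complex.I)) *
      Complex.exp (-(n * t * Complex.I))))
    (g := fun t => Complex.exp (1 / m) *
      Complex.exp (dowlingExponent m r δ t - n * t * Complex.I))
    (u := fun j => Real.exp (r * |δ|) * ((1 / m * Real.exp (m * |δ|)) ^ j / j !))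
    (fun j => by fun_prop) ((Real.summable_pow_div_factorial _).mul_left _)
    (fun j t => by
      rw [norm_mul, norm_mul, norm_cexp_nat_mul_I, mul_one, norm_div, norm_pow, norm_div, norm_one,
        Complex.norm_natCast, Complex.norm_natCast, mul_pow, ← Real.exp_nat_mul]
      have h1 : ‖Complex.exp (((m * j + r) * δ : ℂ) * Complex.exp (t * Complex.I))‖ ≤
          Real.exp (r * |δ|) * Real.exp (j * (m * |δ|)) := by
        rw [← Real.exp_add]
        refine (Complex.norm_exp_le_exp_norm _).trans (Real.exp_le_exp.mpr (le_of_eq ?_))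
        have : (((m * j + r) * δ : ℂ)) = (((m * j + r : ℕ) : ℂ)) * ((δ : ℝ) : ℂ) := by push_cast; ring
        rw [norm_mul, Complex.norm_exp_ofReal_mul_I, this, norm_mul, Complex.norm_natCast,
          Complex.norm_real, Real.norm_eq_abs]
        push_cast
        ring
      calc _ ≤ (1 / m : ℝ) ^ j / j ! * (Real.exp (r * |δ|) * Real.exp (j * (m * |δ|))) := by gcongr
        _ = _ := by ring)
    (fun t => by
      have h1 := ((hasSum_cexp
        ((1 / m : ℂ) * Complex.exp (m * (δ * Complex.exp (t * Complex.I))))).mul_right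
        (Complex.exp (r * (δ * Complex.exp (t * Complex.I))) *
          Complex.exp (-(n * t * Complex.I))))
      convert! h1 using 1
      · funext j
        rw [mul_pow, ← Complex.exp_nat_mul, show ((m * j + r) * δ : ℂ) *
          Complex.exp (t * Complex.I) = j * (m * (δ * Complex.exp (t * Complex.I))) +
          r * (δ * Complex.exp (t * Complex.I)) by ring, Complex.exp_add]
        ring
      · rw [← Complex.exp_add, ← Complex.exp_add, ← Complex.exp_add, dowlingExponent]
        congr 1
        field_simp
        ring)
  simp_rw [intervalIntegral.integral_const_mul, integral_cexp_mul_cexp_I] at h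
  have h2 := (Complex.hasSum_ofReal.mpr (hasSum_rDowling hm r n)).mul_left
    ((2 * Real.pi * (δ ^ n / n !) : ℝ) : ℂ)
  have h3 := h.unique (a₂ := ((2 * Real.pi * (δ ^ n / n !) : ℝ) : ℂ) *
    ((Real.exp (1 / m) * rDowling m r n : ℝ) : ℂ)) (by
      convert! h2 using 2 with j
      rw [mul_pow]
      push_cast
      ring)
  refine mul_left_cancel₀ (Complex.exp_ne_zero (1 / m)) (h3.trans ?_)
  push_cast
  ring

/-! ### Elementary estimates and a Gaussian integral -/

theorem norm_le_of_norm_deriv_le_pow {f f' : ℝ → ℂ} {K : ℝ} (hK : 0 ≤ K) {k : ℕ}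
    (hf : ∀ t, HasDerivAt f (f' t) t) (h0 : f 0 = 0) (hf' : ∀ t, ‖f' t‖ ≤ K * |t| ^ k) (t : ℝ) :
    ‖f t‖ ≤ K * |t| ^ (k + 1) := by
  have h := (convex_Icc (-|t|) |t|).norm_image_sub_le_of_norm_hasDerivWithin_le
    (f := f) (f' := f') (C := K * |t| ^ k) (x := 0) (y := t)
    (fun s _ => (hf s).hasDerivWithinAt)
    (fun s hs => (hf' s).trans (by
      have : |s| ≤ |t| := abs_le.mpr hs
      gcongr))
    (by simp) ⟨neg_abs_le t, le_abs_self t⟩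
  rw [h0, sub_zero, sub_zero, Real.norm_eq_abs] at h
  rwa [pow_succ, ← mul_assoc]

theorem norm_cexp_sub_cexp_le {a b : ℂ} {M : ℝ} (ha : a.re ≤ M) (hb : b.re ≤ M) :
    ‖Complex.exp a - Complex.exp b‖ ≤ Real.exp M * ‖a - b‖ :=
  (convex_halfSpace_re_le M).norm_image_sub_le_of_norm_hasDerivWithin_le
    (fun z _ => (Complex.hasDerivAt_exp z).hasDerivWithinAt)
    (fun z hz => by
      rw [Complex.norm_exp]
      exact Real.exp_le_exp.mpr hz) hb ha

theorem integrable_abs_pow_three_mul_exp_neg_mul_sq {b : ℝ} (hb : 0 < b) :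
    MeasureTheory.Integrable fun t : ℝ => |t| ^ 3 * Real.exp (-b * t ^ 2) := by
  have h := (integrable_rpow_mul_exp_neg_mul_sq hb (s := 3) (by norm_num)).norm
  refine h.congr (.of_forall fun t => ?_)
  have h3 : t ^ (3 : ℝ) = t ^ 3 := by exact_mod_cast Real.rpow_natCast t 3
  simp [h3, abs_of_pos (Real.exp_pos _)]

theorem integral_abs_pow_three_mul_exp_neg_mul_sq {b : ℝ} (hb : 0 < b) :
    ∫ t : ℝ, |t| ^ 3 * Real.exp (-b * t ^ 2) = 1 / b ^ 2 := by
  have h := integral_comp_abs (f := fun t : ℝ => t ^ 3 * Real.exp (-b * t ^ 2))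
  simp only [sq_abs] at h
  rw [h]
  have h2 := integral_rpow_mul_exp_neg_mul_rpow (p := 2) (q := 3) (b := b)
    (by norm_num) (by norm_num) hb
  have e : ((3 : ℝ) + 1) / 2 = 2 := by norm_num
  have e' : -((3 : ℝ) + 1) / 2 = -(2 : ℕ) := by norm_num
  rw [e, e', Real.rpow_neg hb.le, Real.rpow_natCast, Real.Gamma_two] at h2
  have h3 : ∀ t : ℝ, t ^ (3 : ℝ) = t ^ 3 := fun t => by exact_mod_cast Real.rpow_natCast t 3
  simp only [h3, Real.rpow_two] at h2
  rw [h2]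
  ring

/-! ### Estimates at the saddle point -/

section SaddlePoint

variable {m n r : ℕ} {δ : ℝ}

/-- The saddle point satisfies `m δ < log n`: otherwise `δ n ≤ δ e ^ (m δ) ≤ n` forces `δ ≤ 1`, and
then `m δ ≤ m < log n`. -/
theorem saddlePoint_mul_lt_log (hn : 0 < n) (hmn : Real.exp m < n)
    (hδ : 0 < δ) (h : δ * (r + Real.exp (m * δ)) = n) : m * δ < Real.log n := by
  have hn' : (0 : ℝ) < n := by exact_mod_cast hn
  have hL : (m : ℝ) < Real.log n := (Real.lt_log_iff_exp_lt hn').mpr hmn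
  by_contra! hc
  have h1 : (n : ℝ) ≤ Real.exp (m * δ) := (Real.log_le_iff_le_exp hn').mp hc
  have h2 : δ * n ≤ n := by
    calc δ * n ≤ δ * (r + Real.exp (m * δ)) := by
          gcongr
          linarith [Nat.cast_nonneg (α := ℝ) r]
      _ = n := h
  have h3 : δ ≤ 1 := by
    by_contra! h3
    nlinarith
  nlinarith [Nat.cast_nonneg (α := ℝ) m]

theorem le_two_mul_gTwo : (n : ℝ) ≤ 2 * gTwo m n δ := by
  rw [gTwo]
  have : 0 ≤ m * δ ^ 2 * Real.exp (m * δ) := by positivity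
  linarith

theorem two_mul_gTwo_le {L : ℝ} (hδ : 0 < δ) (h : δ * (r + Real.exp (m * δ)) = n) (hL : 1 ≤ L)
    (hx : m * δ ≤ L) : 2 * gTwo m n δ ≤ 2 * n * L := by
  rw [gTwo]
  have h0 : 0 ≤ δ * r := by positivity
  have h1 : m * δ ^ 2 * Real.exp (m * δ) ≤ L * n := by
    calc m * δ ^ 2 * Real.exp (m * δ) = (m * δ) * (δ * Real.exp (m * δ)) := by ring
      _ ≤ L * n := by
        gcongr
        linarith
  nlinarith [Nat.cast_nonneg (α := ℝ) n]

/-- At the saddle point, the exponent `dowlingExponent m r δ t - n t i` agrees with its second-order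
Taylor polynomial up to a cubic error. -/
theorem norm_dowlingExponent_sub_le {L : ℝ} (hm : 0 < m) (hδ : 0 < δ)
    (h : δ * (r + Real.exp (m * δ)) = n) (hL : 1 ≤ L) (hx : m * δ ≤ L) (t : ℝ) :
    ‖dowlingExponent m r δ t - gZero m r δ - n * t * Complex.I + gTwo m n δ * t ^ 2‖ ≤
      5 * n * L ^ 2 * |t| ^ 3 := by
  have hm' : (m : ℂ) ≠ 0 := by exact_mod_cast hm.ne'
  -- The derivatives of `t ↦ r u + (e ^ (m u) - 1) / m` for `u = δ e ^ (i t)`, `u' = i u`, are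
  -- `i q₁`, `-q₂` and `-i q₃`.
  set u : ℝ → ℂ := fun t => δ * Complex.exp (t * Complex.I) with hu
  set q₁ : ℝ → ℂ := fun t => r * u t + u t * Complex.exp (m * u t) with hq₁
  set q₂ : ℝ → ℂ := fun t => q₁ t + m * u t ^ 2 * Complex.exp (m * u t) with hq₂
  set q₃ : ℝ → ℂ := fun t =>
    r * u t + u t * Complex.exp (m * u t) * (1 + 3 * (m * u t) + (m * u t) ^ 2) with hq₃
  have du : ∀ t, HasDerivAt u (Complex.I * u t) t := fun t => by
    have h1 : HasDerivAt (fun t : ℝ => (t : ℂ) * Complex.I) (1 * Complex.I) t :=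
      (HasDerivAt.ofReal_comp (hasDerivAt_id t)).mul_const Complex.I
    convert! (h1.cexp.const_mul (δ : ℂ)) using 1
    simp only [hu]
    ring
  have de : ∀ t, HasDerivAt (fun t => Complex.exp (m * u t))
      (Complex.exp (m * u t) * (m * (Complex.I * u t))) t :=
    fun t => ((du t).const_mul (m : ℂ)).cexp
  have d0 : ∀ t, HasDerivAt (dowlingExponent m r δ) (Complex.I * q₁ t) t := fun t => by
    convert! ((du t).const_mul (r : ℂ)).add (((de t).sub_const 1).div_const (m : ℂ)) using 1
    simp only [hq₁]
    field_simp
  have d1 : ∀ t, HasDerivAt q₁ (Complex.I * q₂ t) t := fun t => by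
    convert! ((du t).const_mul (r : ℂ)).add ((du t).mul (de t)) using 1
    simp only [hq₂, hq₁]
    ring
  have d2 : ∀ t, HasDerivAt q₂ (Complex.I * q₃ t) t := fun t => by
    convert! (d1 t).add ((((du t).pow 2).const_mul (m : ℂ)).mul (de t)) using 1
    simp only [hq₃, hq₂, hq₁]
    simp
    ring
  have hnu : ∀ t, ‖u t‖ = δ := fun t => by
    simp only [hu]
    rw [norm_mul, Complex.norm_exp_ofReal_mul_I, Complex.norm_real, Real.norm_eq_abs,
      abs_of_pos hδ, mul_one]
  have hnmu : ∀ t, ‖(m : ℂ) * u t‖ = m * δ := fun t => by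
    rw [norm_mul, Complex.norm_natCast, hnu]
  have hq₃le : ∀ t, ‖q₃ t‖ ≤ 5 * n * L ^ 2 := fun t => by
    have hp : ‖1 + 3 * (m * u t) + (m * u t) ^ 2‖ ≤ 5 * L ^ 2 := by
      calc ‖1 + 3 * (m * u t) + (m * u t) ^ 2‖ ≤ ‖(1 : ℂ)‖ + ‖3 * (m * u t)‖ + ‖(m * u t) ^ 2‖ :=
            norm_add₃_le
        _ = 1 + 3 * (m * δ) + (m * δ) ^ 2 := by
            rw [norm_pow, norm_mul, hnmu]
            norm_num
        _ ≤ 1 + 3 * L + L ^ 2 := by gcongr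
        _ ≤ 5 * L ^ 2 := by nlinarith
    calc ‖q₃ t‖ ≤ ‖(r : ℂ) * u t‖ +
          ‖u t * Complex.exp (m * u t) * (1 + 3 * (m * u t) + (m * u t) ^ 2)‖ := norm_add_le _ _
      _ ≤ r * δ + δ * Real.exp (m * δ) * (5 * L ^ 2) := by
          rw [norm_mul (r : ℂ), norm_mul (u t * _), norm_mul (u t), Complex.norm_natCast, hnu]
          gcongr
          exact (Complex.norm_exp_le_exp_norm _).trans_eq (by rw [hnmu])
      _ ≤ r * δ * (5 * L ^ 2) + δ * Real.exp (m * δ) * (5 * L ^ 2) := by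
          have : 0 ≤ r * δ := by positivity
          nlinarith [one_le_pow₀ (n := 2) hL]
      _ = 5 * n * L ^ 2 := by rw [← h]; ring
  have hu0 : u 0 = δ := by simp [hu]
  have h1 : q₁ 0 = n := by
    simp only [hq₁, hu0]
    have := congrArg (fun y : ℝ => (y : ℂ)) h
    push_cast at this
    rw [← this]
    ring
  have h2 : q₂ 0 = 2 * gTwo m n δ := by
    simp only [hq₂, h1, hu0, gTwo]
    push_cast
    ring
  have hK : 0 ≤ 5 * n * L ^ 2 := by positivity
  have r2 := norm_le_of_norm_deriv_le_pow (f := fun t => 2 * gTwo m n δ - q₂ t) hK (k := 0)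
    (fun t => (d2 t).const_sub _) (by rw [h2, sub_self])
    (fun t => by
      rw [norm_neg, norm_mul, Complex.norm_I, one_mul, pow_zero, mul_one]
      exact hq₃le t)
  have r1 := norm_le_of_norm_deriv_le_pow
    (f := fun t => Complex.I * q₁ t - n * Complex.I + 2 * gTwo m n δ * (t : ℂ))
    (f' := fun t => 2 * gTwo m n δ - q₂ t) hK
    (fun t => by
      convert! (((d1 t).const_mul Complex.I).sub_const (n * Complex.I)).add
        ((HasDerivAt.ofReal_comp (hasDerivAt_id t)).const_mul (2 * gTwo m n δ : ℂ)) using 1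
      rw [← mul_assoc, Complex.I_mul_I]
      push_cast
      ring)
    (by rw [h1]; push_cast; ring) r2
  exact norm_le_of_norm_deriv_le_pow
    (f := fun t => dowlingExponent m r δ t - gZero m r δ - n * t * Complex.I + gTwo m n δ * t ^ 2)
    (f' := fun t => Complex.I * q₁ t - n * Complex.I + 2 * gTwo m n δ * (t : ℂ)) hK
    (fun t => by
      have d := HasDerivAt.ofReal_comp (hasDerivAt_id t)
      convert! (((d0 t).sub_const (gZero m r δ : ℂ)).sub
        ((d.const_mul (n : ℂ)).mul_const Complex.I)).add
        ((d.pow 2).const_mul (gTwo m n δ : ℂ)) using 1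
      simp
      ring)
    (by rw [dowlingExponent_zero]; push_cast; ring) r1 t

/-- On the whole circle the generating function decays like a Gaussian away from the positive real
axis. The term `e ^ (m z)` is treated with `e ^ (-y) ≤ 1 / (1 + y)`, where `y = m δ (1 - cos t)` is
at most `2 L`. -/
theorem re_dowlingExponent_sub_le {L : ℝ} (hm : 0 < m) (hδ : 0 < δ)
    (h : δ * (r + Real.exp (m * δ)) = n) (hL : 1 ≤ L) (hx : m * δ ≤ L) {t : ℝ}
    (ht : |t| ≤ Real.pi) :
    (dowlingExponent m r δ t).re - gZero m r δ ≤ -(n / (15 * L)) * t ^ 2 := by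
  have hm' : (0 : ℝ) < m := by exact_mod_cast hm
  set c : ℝ := 1 - Real.cos t with hc
  have hc0 : 0 ≤ c := by linarith [Real.cos_le_one t]
  have hc2 : c ≤ 2 := by linarith [Real.neg_one_le_cos t]
  have hct : t ^ 2 / 5 ≤ c := by
    have h1 := Real.cos_le_one_sub_mul_cos_sq ht
    have h2 : 1 / 5 ≤ 2 / Real.pi ^ 2 := by
      rw [div_le_div_iff₀ (by norm_num) (by positivity)]
      nlinarith [Real.pi_lt_d2, Real.pi_pos]
    nlinarith [sq_nonneg t]
  have hre : (dowlingExponent m r δ t).re ≤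
      r * (δ * Real.cos t) + (Real.exp (m * (δ * Real.cos t)) - 1) / m := by
    have h1 : (δ * Complex.exp (t * Complex.I)).re = δ * Real.cos t := by
      rw [Complex.re_ofReal_mul, Complex.exp_ofReal_mul_I_re]
    have h2 : (Complex.exp (m * (δ * Complex.exp (t * Complex.I)))).re ≤
        Real.exp (m * (δ * Real.cos t)) := by
      refine (Complex.re_le_norm _).trans_eq ?_
      rw [Complex.norm_exp, ← Complex.ofReal_natCast m, Complex.re_ofReal_mul, h1]
    rw [dowlingExponent, Complex.add_re, ← Complex.ofReal_natCast r, ← Complex.ofReal_natCast m,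
      Complex.re_ofReal_mul, h1, Complex.div_ofReal_re, Complex.sub_re, Complex.one_re]
    gcongr
    simpa using h2
  have hexp : Real.exp (m * (δ * Real.cos t)) ≤
      Real.exp (m * δ) * (1 - m * δ * c / (3 * L)) := by
    have h1 : m * (δ * Real.cos t) = m * δ + -(m * δ * c) := by rw [hc]; ring
    rw [h1, Real.exp_add]
    gcongr
    have hy : 0 ≤ m * δ * c := by positivity
    have hy2 : 1 + m * δ * c ≤ 3 * L := by nlinarith [mul_le_mul hx hc2 hc0 (by linarith)]
    calc Real.exp (-(m * δ * c)) ≤ (1 + m * δ * c)⁻¹ := by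
          rw [Real.exp_neg]
          gcongr
          linarith [Real.add_one_le_exp (m * δ * c)]
      _ = 1 - m * δ * c / (1 + m * δ * c) := by field_simp; ring
      _ ≤ 1 - m * δ * c / (3 * L) := by gcongr
  calc (dowlingExponent m r δ t).re - gZero m r δ
      ≤ r * (δ * Real.cos t) + (Real.exp (m * δ) * (1 - m * δ * c / (3 * L)) - 1) / m -
        gZero m r δ := by
        gcongr
        exact hre.trans (by gcongr)
    _ = -(r * δ * c) - δ * Real.exp (m * δ) * (c / (3 * L)) := by
        rw [gZero, hc]
        field_simp
        ring
    _ ≤ -(r * δ * (c / (3 * L))) - δ * Real.exp (m * δ) * (c / (3 * L)) := by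
        gcongr
        exact div_le_self hc0 (by linarith)
    _ = -(n * c / (3 * L)) := by rw [← h]; ring
    _ ≤ -(n * (t ^ 2 / 5) / (3 * L)) := by gcongr
    _ = -(n / (15 * L)) * t ^ 2 := by field_simp; ring

open scoped Nat in
/-- The saddle-point estimate with an absolute error term: the integrand of Cauchy's formula and the
Gaussian with the same second-order expansion differ by at most a multiple of
`|t| ^ 3 e ^ (-b t ^ 2)`, pointwise on the whole line. -/
theorem abs_two_pi_mul_rDowling_sub_le {L : ℝ} (hm : 0 < m) (hn : 0 < n) (hδ : 0 < δ)
    (h : δ * (r + Real.exp (m * δ)) = n) (hL : 1 ≤ L) (hx : m * δ ≤ L) :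
    |2 * Real.pi * (δ ^ n / n ! * rDowling m r n) * Real.exp (-gZero m r δ) -
      √(Real.pi / gTwo m n δ)| ≤ 1125 * L ^ 4 / n := by
  have hn' : (1 : ℝ) ≤ n := by exact_mod_cast hn
  set b : ℝ := n / (15 * L) with hb
  have hb0 : 0 < b := by positivity
  have hg := le_two_mul_gTwo (m := m) (n := n) (δ := δ)
  have hg0 : 0 < gTwo m n δ := by linarith
  have hbg : b ≤ gTwo m n δ := by
    have : b ≤ n / 2 := by
      rw [hb]
      gcongr
      linarith
    linarith
  set F : ℝ → ℂ := fun t =>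
    Complex.exp (dowlingExponent m r δ t - gZero m r δ - n * t * Complex.I) with hF
  set G : ℝ → ℂ := fun t => Complex.exp (-(gTwo m n δ * t ^ 2)) with hG
  set B : ℝ → ℝ := fun t => 5 * n * L ^ 2 * (|t| ^ 3 * Real.exp (-b * t ^ 2)) with hB
  set s : Set ℝ := Set.Ioc (-Real.pi) Real.pi with hs
  have hGre : ∀ t : ℝ, (-(gTwo m n δ * t ^ 2) : ℂ).re ≤ -b * t ^ 2 := fun t => by
    rw [show (-(gTwo m n δ * t ^ 2) : ℂ) = ((-(gTwo m n δ * t ^ 2) : ℝ) : ℂ) by push_cast; ring,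
      Complex.ofReal_re]
    nlinarith [sq_nonneg t]
  have hpt : ∀ t, ‖s.indicator F t - G t‖ ≤ B t := by
    intro t
    by_cases ht : t ∈ s
    · rw [Set.indicator_of_mem ht]
      have h1 := norm_cexp_sub_cexp_le
        (a := dowlingExponent m r δ t - gZero m r δ - n * t * Complex.I)
        (b := -(gTwo m n δ * t ^ 2)) (M := -b * t ^ 2)
        (by
          have := re_dowlingExponent_sub_le hm hδ h hL hx (abs_le.mpr ⟨ht.1.le, ht.2⟩)
          simpa using this) (hGre t)
      rw [sub_neg_eq_add] at h1
      calc ‖F t - G t‖ ≤ _ := h1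
        _ ≤ Real.exp (-b * t ^ 2) * (5 * n * L ^ 2 * |t| ^ 3) := by
          gcongr
          exact norm_dowlingExponent_sub_le hm hδ h hL hx t
        _ = B t := by rw [hB]; ring
    -- Off `(-π, π]` only the Gaussian is left, and there `1 ≤ |t|`.
    · rw [Set.indicator_of_notMem ht, zero_sub, norm_neg, hG, Complex.norm_exp]
      have ht1 : 1 ≤ |t| := by
        by_contra! hlt
        have := abs_lt.mp hlt
        exact ht ⟨by linarith [Real.pi_gt_three], by linarith [Real.pi_gt_three]⟩
      calc Real.exp (-(gTwo m n δ * t ^ 2) : ℂ).re ≤ Real.exp (-b * t ^ 2) :=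
            Real.exp_le_exp.mpr (hGre t)
        _ = 1 * 1 * 1 * (1 * Real.exp (-b * t ^ 2)) := by ring
        _ ≤ B t := by
          simp only [hB]
          gcongr
          · norm_num
          · exact one_le_pow₀ hL
          · exact one_le_pow₀ ht1
  have hFint : MeasureTheory.Integrable (s.indicator F) := by
    rw [MeasureTheory.integrable_indicator_iff measurableSet_Ioc]
    exact (Continuous.integrableOn_Icc (by fun_prop)).mono_set Set.Ioc_subset_Icc_self
  have hGeq : G = fun t : ℝ => ((Real.exp (-gTwo m n δ * t ^ 2) : ℝ) : ℂ) := by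
    funext t
    rw [hG]
    push_cast
    ring_nf
  have hGint : MeasureTheory.Integrable G := by
    rw [hGeq]
    exact (integrable_exp_neg_mul_sq hg0).ofReal
  have hGval : ∫ t, G t = (√(Real.pi / gTwo m n δ) : ℝ) := by
    rw [hGeq, integral_complex_ofReal, integral_gaussian]
  have hFval : ∫ t, s.indicator F t =
      ((2 * Real.pi * (δ ^ n / n ! * rDowling m r n) * Real.exp (-gZero m r δ) : ℝ) : ℂ) := by
    rw [MeasureTheory.integral_indicator measurableSet_Ioc,
      ← intervalIntegral.integral_of_le (by linarith [Real.pi_pos]), Complex.ofReal_mul,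
      ← integral_cexp_dowlingExponent hm, ← intervalIntegral.integral_mul_const]
    refine intervalIntegral.integral_congr fun t _ => ?_
    simp only [hF]
    rw [Complex.ofReal_exp, ← Complex.exp_add]
    congr 1
    push_cast
    ring
  calc _ = ‖∫ t, (s.indicator F t - G t)‖ := by
        rw [MeasureTheory.integral_sub hFint hGint, hFval, hGval, ← Complex.ofReal_sub,
          Complex.norm_real, Real.norm_eq_abs]
    _ ≤ ∫ t, B t := MeasureTheory.norm_integral_le_of_norm_le
        ((integrable_abs_pow_three_mul_exp_neg_mul_sq hb0).const_mul _) (.of_forall hpt)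
    _ = 1125 * L ^ 4 / n := by
        rw [hB, MeasureTheory.integral_const_mul, integral_abs_pow_three_mul_exp_neg_mul_sq hb0, hb]
        field_simp
        ring

end SaddlePoint

/-! ### The asymptotic formula -/

theorem existsUnique_saddlePoint (m r : ℕ) {n : ℕ} (hn : 0 < n) :
    ∃! δ : ℝ, 0 < δ ∧ δ * (r + Real.exp (m * δ)) = n := by
  have hn' : (0 : ℝ) < n := by exact_mod_cast hn
  obtain ⟨δ, hδ, h⟩ : ∃ δ ∈ Set.Icc (0 : ℝ) n, δ * (r + Real.exp (m * δ)) = n := by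
    refine intermediate_value_Icc hn'.le (f := fun δ : ℝ => δ * (r + Real.exp (m * δ)))
      (by fun_prop) ⟨by simp, ?_⟩
    have h1 : 1 ≤ Real.exp (m * n) := Real.one_le_exp (by positivity)
    nlinarith [Nat.cast_nonneg (α := ℝ) r]
  have hmono : StrictMonoOn (fun δ : ℝ => δ * (r + Real.exp (m * δ))) (Set.Ioi 0) := by
    intro a ha b hb hab
    have ha' : (0 : ℝ) < a := ha
    have : Real.exp (m * a) ≤ Real.exp (m * b) := by gcongr
    calc a * (r + Real.exp (m * a)) < b * (r + Real.exp (m * a)) := by gcongr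
      _ ≤ b * (r + Real.exp (m * b)) := by
        gcongr
        exact (ha'.trans hab).le
  have hδ0 : 0 < δ := by
    refine lt_of_le_of_ne hδ.1 fun h0 => ?_
    rw [← h0, zero_mul] at h
    exact hn'.ne h
  exact ⟨δ, ⟨hδ0, h⟩, fun y hy => hmono.injOn hy.1 hδ0 (hy.2.trans h.symm)⟩

theorem mainTheorem5 :
    ∃ C : ℝ, 0 < C ∧ ∀ m n r : ℕ, 0 < m → 0 < n → 0 < r → Real.exp m < n →
      (∃! δ : ℝ, 0 < δ ∧ δ * (r + Real.exp (m * δ)) = n) ∧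
      ∀ δ : ℝ, 0 < δ → δ * (r + Real.exp (m * δ)) = n →
        ∃ E : ℝ, |E| ≤ C * (Real.log n ^ 12 / Real.sqrt n) ∧
          rDowling m r n =
            Real.exp (gZero m r δ) / Real.sqrt (4 * Real.pi * gTwo m n δ) *
              ((n.factorial : ℝ) / δ ^ n) * (1 + E) := by
  refine ⟨2250, by norm_num, fun m n r hm hn _ hmn => ⟨existsUnique_saddlePoint m r hn,
    fun δ hδ h => ?_⟩⟩
  have hn' : (1 : ℝ) ≤ n := by exact_mod_cast hn
  set L : ℝ := Real.log n with hLdef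
  have hL : 1 ≤ L := by
    have h1 : (m : ℝ) < L := (Real.lt_log_iff_exp_lt (by linarith)).mpr hmn
    have h2 : (1 : ℝ) ≤ m := by exact_mod_cast hm
    linarith
  have hx : m * δ ≤ L := (saddlePoint_mul_lt_log hn hmn hδ h).le
  have hg0 : 0 < gTwo m n δ := by linarith [le_two_mul_gTwo (m := m) (n := n) (δ := δ)]
  have hmain := abs_two_pi_mul_rDowling_sub_le hm hn hδ h hL hx
  -- The prefactor `1 / √(4 π g₂)` of the theorem is the Gaussian integral `√(π / g₂)` over `2 π`.
  have hsq : √(4 * Real.pi * gTwo m n δ) * √(Real.pi / gTwo m n δ) = 2 * Real.pi := by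
    rw [← Real.sqrt_mul (by positivity), show 4 * Real.pi * gTwo m n δ * (Real.pi / gTwo m n δ) =
      (2 * Real.pi) ^ 2 by field_simp; ring, Real.sqrt_sq (by positivity)]
  set Q : ℝ := √(4 * Real.pi * gTwo m n δ) with hQ
  have hQ0 : 0 < Q := by positivity
  set A : ℝ := δ ^ n / n.factorial * rDowling m r n * Real.exp (-gZero m r δ) with hA
  have hQle : Q ≤ 4 * Real.pi * L * √n := by
    refine Real.sqrt_le_iff.mpr ⟨by positivity, ?_⟩
    rw [mul_pow, Real.sq_sqrt (by linarith)]
    have h1 := two_mul_gTwo_le hδ h hL hx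
    calc 4 * Real.pi * gTwo m n δ ≤ 4 * Real.pi * (n * L) := by gcongr; linarith
      _ = (4 * Real.pi * L) * 1 * n := by ring
      _ ≤ (4 * Real.pi * L) * (4 * Real.pi * L) * n := by
        gcongr
        nlinarith [Real.pi_gt_three]
      _ = _ := by ring
  refine ⟨A * Q - 1, ?_, ?_⟩
  · have h1 : A * Q - 1 = Q / (2 * Real.pi) * (2 * Real.pi *
        (δ ^ n / n.factorial * rDowling m r n) * Real.exp (-gZero m r δ) -
        √(Real.pi / gTwo m n δ)) := by
      rw [mul_sub, div_mul_eq_mul_div Q _ (√(Real.pi / gTwo m n δ)), hsq,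
        div_self (by positivity), hA]
      field_simp
    rw [h1, abs_mul, abs_of_pos (by positivity)]
    calc _ ≤ 4 * Real.pi * L * √n / (2 * Real.pi) * (1125 * L ^ 4 / n) := by gcongr
      _ = 2250 * (L ^ 5 * (√n / n)) := by field_simp; ring
      _ = 2250 * (L ^ 5 / √n) := by rw [Real.sqrt_div_self', mul_one_div]
      _ ≤ 2250 * (L ^ 12 / √n) := by
        gcongr
        norm_num
  · rw [add_sub_cancel, hA, Real.exp_neg]
    field_simp
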